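/- **Asymmetric hub model.** There are $n$ nodes, the first $n_L\le n$ of which are the possible hubs. The parameters are $\rho=(\rho_1,\dots,\rho_{n_L})$ with $\rho_i\ge 0$, $\sum_i\rho_i=1$, and an $n_L\times n$ matrix $A$ with entries in $[0,1]$ and $A_{ii}=1$ for $i\le n_L$. One observes $T$ independent groups $G^{(t)}\in\{0,1\}^n$: a latent hub $z_*^{(t)}$ is drawn with $\mathbb P(z_*^{(t)}=i)=\rho_i$, and given $z_*^{(t)}=i$ the coordinates $G^{(t)}_j$ are independent with $\mathbb P(G_j^{(t)}=1\mid z_*^{(t)}=i)=A_{ij}$. For an assignment $z\in\{1,\dots,n_L\}^T$ let $$L_G(z)=\max_{B}\ \sum_{t=1}^T\sum_{j=1}^n\Big(G_j^{(t)}\log B_{z^{(t)}j}+(1-G_j^{(t)})\log(1-B_{z^{(t)}j})\Big)$$ ($\log 0=-\infty$, $0\cdot\log 0=0$), the maximum being over $n_L\times n$ matrices $B$ with entries in $[0,1]$ and $B_{ii}=1$ for $i\le n_L$. Let $\hat z$ be any maximizer of $L_G$, and let $T_e=\#\{t: \hat z^{(t)}\ne z_*^{(t)}\}$. The sizes $n_L,n,T$,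 the parameters $\rho,A$ and the numbers $d,v>0$ may all vary along the asymptotics. Assume throughout that there are constants $c_{\min},c_{\max}>0$ with $c_{\min}/n_L\le\rho_i\le c_{\max}/n_L$ for all $i$, and that (i) there are sets $V_i\subset\{1,\dots,n\}$, $i=1,\dots,n_L$, with $|V_i|\ge vn/n_L$ and $A_{ij}-A_{i'j}\ge d$ for all $j\in V_i$ and $i'\ne i$. **Theorem 4.** Suppose that, for some constant $c_0>0$, $A_{ii'}\le c_0/n_L$ for all distinct $i,i'\le n_L$. If $n_L^2\log n_L/T\to0$, $n_L^2\log T/(d^2vT)\to0$ and $n_L^2\log n_L/(d^4v^2n)\to0$, then $T_e/T=o_p(1)$, i.e. $\mathbb P(T_e/T\ge\varepsilon)\to0$ for every $\varepsilon>0$, as $n_L,n,T\to\infty$. **Theorem 4′.** Let $n_L$ be fixed and suppose that $A_{ii'}\le c$ for all distinct $i,i'\le n_L$, with a constant $c<1$. If $\log T/(d^2vT)\to0$ and $d^4v^2n\to\infty$, then $T_e/T=o_p(1)$ as $n,T\to\infty$. **Theorem 4″.** Let $n_L$ be fixed, suppose that $A_{ii'}\le c$ for all distinct $i,i'\le n_L$,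 with a constant $c<1$, and let $d$ and $v$ be constants. Then $T_e/T=o_p(1)$ as $n,T\to\infty$. -/

import Mathlib

open MeasureTheory ProbabilityTheory Filter Topology

noncomputable section

namespace HubModel

/-- The matrices `A` of size `nL × n` that are admissible in the asymmetric hub model: entries in
`[0, 1]`, and `A i i = 1` for every hub `i`. Hubs are the first `nL` of the `n` nodes. -/
def Admissible {nL n : ℕ} (h : nL ≤ n) : Set (Matrix (Fin nL) (Fin n) ℝ) :=
  {A | (∀ i j, A i j ∈ Set.Icc (0 : ℝ) 1) ∧ ∀ i, A i (Fin.castLE h i) = 1}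

/-- Parameters `(ρ, A)` of the asymmetric hub model with `n` nodes and hub set the first `nL`. -/
structure Params (nL n : ℕ) where
  le : nL ≤ n
  ρ : Fin nL → ℝ
  A : Matrix (Fin nL) (Fin n) ℝ
  ρ_nonneg : ∀ i, 0 ≤ ρ i
  ρ_sum : ∑ i, ρ i = 1
  A_mem : A ∈ Admissible le

/-- The probability that a Bernoulli variable with parameter `p` takes the value `b`. -/
def bern (p : ℝ) (b : Bool) : ℝ := if b then p else 1 - p

/-- `(zs, G)` is a sample of `T` groups with their hubs: `zs ω t` is the true hub of group `t`, and
`G ω t j` tells whether node `j` appears in group `t`. The pairs (hub, group) are independent over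
`t`; the hub is drawn from `ρ` and, given that the hub is `i`, the nodes `j` appear independently
with probabilities `A i j`. -/
structure IsSample {nL n T : ℕ} (P : Params nL n) {Ω : Type*} [MeasurableSpace Ω] (μ : Measure Ω)
    (zs : Ω → Fin T → Fin nL) (G : Ω → Fin T → Fin n → Bool) : Prop where
  measurable_zs : Measurable zs
  measurable_G : Measurable G
  indep : iIndepFun (fun (t : Fin T) (ω : Ω) => (zs ω t, G ω t)) μ
  law : ∀ (t : Fin T) (i : Fin nL) (g : Fin n → Bool),
    μ.real {ω | zs ω t = i ∧ G ω t = g} = P.ρ i * ∏ j, bern (P.A i j) (g j)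

/-- The log-likelihood `L_G(A | z)` of the data `g` given the hub assignment `z`, with values in the
extended reals so that `log 0 = -∞`. -/
def condLogLik {nL n T : ℕ} (g : Fin T → Fin n → Bool) (A : Matrix (Fin nL) (Fin n) ℝ)
    (z : Fin T → Fin nL) : EReal :=
  ∑ t, ∑ j, ENNReal.log (ENNReal.ofReal (bern (A (z t) j) (g t j)))

/-- The profile log-likelihood `L_G(z)`: the maximum of `L_G(A | z)` over the admissible `A`. -/
def profileLogLik {nL n T : ℕ} (h : nL ≤ n) (g : Fin T → Fin n → Bool)
    (z : Fin T → Fin nL) : EReal :=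
  ⨆ A ∈ Admissible h, condLogLik g A z

/-- `z` is a maximizer of the profile log-likelihood of the data `g`. -/
def IsMaxProfile {nL n T : ℕ} (h : nL ≤ n) (g : Fin T → Fin n → Bool)
    (z : Fin T → Fin nL) : Prop :=
  ∀ z' : Fin T → Fin nL, profileLogLik h g z' ≤ profileLogLik h g z

/-- The number `T_e` of groups whose hub label in `z'` differs from that in `z`. -/
def numErrors {nL T : ℕ} (z z' : Fin T → Fin nL) : ℕ :=
  (Finset.univ.filter fun t => z t ≠ z' t).card

/-- Every hub `i` has a set `V i` of at least `v * n / nL` nodes, each of which prefers hub `i` to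
any other hub by a margin of at least `d`. -/
def Separated {nL n : ℕ} (P : Params nL n) (d v : ℝ) : Prop :=
  ∃ V : Fin nL → Finset (Fin n), ∀ i, v * n / nL ≤ ((V i).card : ℝ) ∧
    ∀ j ∈ V i, ∀ i', i ≠ i' → d ≤ P.A i j - P.A i' j

/-- `A i i' ≤ c` for all pairs of distinct hubs. -/
def HubBound {nL n : ℕ} (P : Params nL n) (c : ℝ) : Prop :=
  ∀ i i' : Fin nL, i ≠ i' → P.A i (Fin.castLE P.le i') ≤ c

end HubModel

end

/-! The maximizer `zhat` must assign every group to a hub contained in it, since otherwise the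
constraint `B i i = 1` makes the likelihood zero (`IsMaxProfile.feasible`). It also beats the true
pair (A, z_*) at some matrix of a finite family: for a given z the optimal B consists of empirical
frequencies (`IsMaxProfile.exists_gridMatrix`).

For a fixed (B, z), the probability of beating the truth is at most a product of Hellinger
affinities, hence at most exp(-S/8), where S is the sum of all (A_{z_*(t) j} - B_{z(t) j})²
(`sum_lik_le_exp`). By separation a row of B is near at most one row of A. So S ≥ d²vn/(4 n_L) · #{t
: z_*(t) ≠ f(z(t))} for some relabeling f (`exists_sum_sq_ge`). A union bound over n_L^T (T+1)^{n_L
n} pairs then excludes every z at distance of order T from all relabelings.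

It remains to see that a feasible z with many errors is far from every relabeling. An error with z_*
= f(z) is a group with hub f(i) ≠ i that contains hub i. When n_L grows such groups are rare
(`numErrors_le_of_hubCount_true_le`). When n_L is fixed, any f ≠ id misses a positive fraction of
the groups: those of some hub k that omit some hub i (`le_card_ne_of_lt_hubCount_false`). -/

noncomputable section

namespace HubModel

/-! ### Likelihoods and the profile maximizer. -/

theorem bern_nonneg {p : ℝ} (hp : p ∈ Set.Icc (0 : ℝ) 1) (b : Bool) : 0 ≤ bern p b := by
  have := hp.1
  have := hp.2
  cases b <;> simp [bern] <;> linarith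

/-- The likelihood of the data `g` given the hub assignment `z`. -/
def lik {nL n T : ℕ} (g : Fin T → Fin n → Bool) (A : Matrix (Fin nL) (Fin n) ℝ)
    (z : Fin T → Fin nL) : ℝ :=
  ∏ t, ∏ j, bern (A (z t) j) (g t j)

theorem lik_nonneg {nL n T : ℕ} {A : Matrix (Fin nL) (Fin n) ℝ}
    (hA : ∀ i j, A i j ∈ Set.Icc (0 : ℝ) 1) (g : Fin T → Fin n → Bool) (z : Fin T → Fin nL) :
    0 ≤ lik g A z :=
  Finset.prod_nonneg fun _ _ => Finset.prod_nonneg fun _ _ => bern_nonneg (hA _ _) _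

theorem ennrealLog_prod {α : Type*} (s : Finset α) (f : α → ENNReal) :
    ENNReal.log (∏ a ∈ s, f a) = ∑ a ∈ s, ENNReal.log (f a) := by
  classical
  induction s using Finset.induction_on with
  | empty => simp
  | insert a s ha ih => rw [Finset.prod_insert ha, Finset.sum_insert ha, ENNReal.log_mul_add, ih]

theorem condLogLik_eq_log_lik {nL n T : ℕ} {A : Matrix (Fin nL) (Fin n) ℝ}
    (hA : ∀ i j, A i j ∈ Set.Icc (0 : ℝ) 1) (g : Fin T → Fin n → Bool) (z : Fin T → Fin nL) :
    condLogLik g A z = ENNReal.log (ENNReal.ofReal (lik g A z)) := by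
  rw [lik, ENNReal.ofReal_prod_of_nonneg
    (fun _ _ => Finset.prod_nonneg fun _ _ => bern_nonneg (hA _ _) _), ennrealLog_prod]
  refine Finset.sum_congr rfl fun t _ => ?_
  rw [ENNReal.ofReal_prod_of_nonneg (fun _ _ => bern_nonneg (hA _ _) _), ennrealLog_prod]

/-- The Bernoulli likelihood is maximal at the empirical frequency. -/
theorem pow_mul_one_sub_pow_le (s r : ℕ) {p : ℝ} (hp : p ∈ Set.Icc (0 : ℝ) 1) :
    p ^ s * (1 - p) ^ r
      ≤ ((s : ℝ) / (s + r : ℕ)) ^ s * (1 - (s : ℝ) / (s + r : ℕ)) ^ r := by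
  obtain ⟨h0, h1⟩ := hp
  have h1' : 0 ≤ 1 - p := by linarith
  rcases Nat.eq_zero_or_pos s with rfl | hs
  · simpa using pow_le_one₀ h1' (by linarith)
  rcases Nat.eq_zero_or_pos r with rfl | hr
  · have : (s : ℝ) ≠ 0 := by positivity
    simpa [this] using pow_le_one₀ h0 h1
  have hs' : (0 : ℝ) < s := by exact_mod_cast hs
  have hr' : (0 : ℝ) < r := by exact_mod_cast hr
  -- From x/y ≤ exp(x/y - 1). For the two factors, with y the empirical frequencies, the exponents
  -- add up to (s + r) - (s + r) = 0.
  have key : ∀ (k : ℕ) (x y : ℝ), 0 < y → 0 ≤ x → x ^ k ≤ y ^ k * Real.exp (k * (x / y - 1)) := by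
    intro k x y hy hx
    rw [Real.exp_nat_mul, ← mul_pow]
    refine pow_le_pow_left₀ hx ?_ _
    have := Real.add_one_le_exp (x / y - 1)
    calc x = y * (x / y - 1 + 1) := by field_simp; ring
      _ ≤ _ := mul_le_mul_of_nonneg_left this hy.le
  have hb : 1 - (s : ℝ) / (s + r : ℕ) = r / (s + r : ℕ) := by
    push_cast; field_simp; ring
  rw [hb]
  have e1 := key s p ((s : ℝ) / (s + r : ℕ)) (by positivity) h0
  have e2 := key r (1 - p) ((r : ℝ) / (s + r : ℕ)) (by positivity) h1'
  refine (mul_le_mul e1 e2 (by positivity) (by positivity)).trans_eq ?_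
  rw [mul_mul_mul_comm, ← Real.exp_add]
  have : (s : ℝ) * (p / (s / (s + r : ℕ)) - 1) + r * ((1 - p) / (r / (s + r : ℕ)) - 1) = 0 := by
    push_cast; field_simp; ring
  rw [this, Real.exp_zero, mul_one]

/-- The entries `K i j / m i`, capped at `1`, where `m i` is the number of groups that `z` assigns
to hub `i`. -/
def gridMatrix {nL n T : ℕ} (z : Fin T → Fin nL) (K : Fin nL → Fin n → Fin (T + 1)) :
    Matrix (Fin nL) (Fin n) ℝ :=
  fun i j => min 1 ((K i j : ℕ) / ((Finset.univ.filter fun t => z t = i).card : ℝ))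

/-- The cap makes this hold for every `K`, so the union bound may run over all pairs `(z, K)`. At
the optimal `K` it is inactive, and an empty class gives entries 0 through division by zero. -/
theorem gridMatrix_mem {nL n T : ℕ} (z : Fin T → Fin nL) (K : Fin nL → Fin n → Fin (T + 1))
    (i : Fin nL) (j : Fin n) : gridMatrix z K i j ∈ Set.Icc (0 : ℝ) 1 :=
  ⟨le_min zero_le_one (by positivity), min_le_left _ _⟩

theorem prod_bern_eq {α : Type*} (s : Finset α) (b : α → Bool) (p : ℝ) :
    ∏ t ∈ s, bern p (b t)
      = p ^ (s.filter fun t => b t = true).card * (1 - p) ^ (s.filter fun t => ¬ b t = true).card := by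
  simp only [bern, Finset.prod_ite, Finset.prod_const]

theorem lik_eq_prod_blocks {nL n T : ℕ} (g : Fin T → Fin n → Bool)
    (A : Matrix (Fin nL) (Fin n) ℝ) (z : Fin T → Fin nL) :
    lik g A z = ∏ j, ∏ i, ∏ t ∈ Finset.univ.filter (fun t => z t = i), bern (A i j) (g t j) := by
  rw [lik, Finset.prod_comm]
  refine Finset.prod_congr rfl fun j _ => ?_
  rw [← Finset.prod_fiberwise Finset.univ z]
  refine Finset.prod_congr rfl fun i _ => Finset.prod_congr rfl fun t ht => ?_
  rw [(Finset.mem_filter.1 ht).2]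

/-- For given `z`, the likelihood is maximal at a matrix of the form `gridMatrix z K`. -/
theorem exists_gridMatrix_lik_ge {nL n T : ℕ} (g : Fin T → Fin n → Bool) (z : Fin T → Fin nL) :
    ∃ K : Fin nL → Fin n → Fin (T + 1), ∀ A : Matrix (Fin nL) (Fin n) ℝ,
      (∀ i j, A i j ∈ Set.Icc (0 : ℝ) 1) → lik g A z ≤ lik g (gridMatrix z K) z := by
  let C : Fin nL → Finset (Fin T) := fun i => Finset.univ.filter fun t => z t = i
  refine ⟨fun i j => ⟨((C i).filter fun t => g t j = true).card, ?_⟩, fun A hA => ?_⟩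
  · exact Nat.lt_succ_of_le ((Finset.card_le_univ _).trans_eq (Fintype.card_fin T))
  · rw [lik_eq_prod_blocks, lik_eq_prod_blocks]
    refine Finset.prod_le_prod (fun j _ => Finset.prod_nonneg fun i _ => Finset.prod_nonneg
      fun t _ => bern_nonneg (hA _ _) _) fun j _ => Finset.prod_le_prod
      (fun i _ => Finset.prod_nonneg fun t _ => bern_nonneg (hA _ _) _) fun i _ => ?_
    rw [prod_bern_eq, prod_bern_eq]
    have hle := pow_mul_one_sub_pow_le ((C i).filter fun t => g t j = true).card
      ((C i).filter fun t => ¬ g t j = true).card (hA i j)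
    rw [Finset.card_filter_add_card_filter_not] at hle
    have hmin : gridMatrix z (fun i j => ⟨((C i).filter fun t => g t j = true).card,
        Nat.lt_succ_of_le ((Finset.card_le_univ _).trans_eq (Fintype.card_fin T))⟩) i j
        = (((C i).filter fun t => g t j = true).card : ℝ) / ((C i).card : ℝ) := by
      refine min_eq_right (div_le_one_of_le₀ ?_ (by positivity))
      exact Nat.cast_le.2 (Finset.card_filter_le (C i) fun t => g t j = true)
    rw [hmin]
    exact hle

/-- A maximizer of the profile likelihood assigns each group to a hub that the group contains. -/
theorem IsMaxProfile.feasible {nL n T : ℕ} {h : nL ≤ n} {g : Fin T → Fin n → Bool}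
    {z : Fin T → Fin nL} (hz : IsMaxProfile h g z) {A : Matrix (Fin nL) (Fin n) ℝ}
    (hA : A ∈ Admissible h) {z₀ : Fin T → Fin nL} (hpos : 0 < lik g A z₀) (t : Fin T) :
    g t (Fin.castLE h (z t)) = true := by
  have h1 : ⊥ < profileLogLik h g z := by
    refine lt_of_lt_of_le ?_ ((le_iSup₂ (f := fun A _ => condLogLik g A z₀) A hA).trans (hz z₀))
    rw [condLogLik_eq_log_lik hA.1, bot_lt_iff_ne_bot, Ne, ENNReal.log_eq_bot_iff]
    simpa using hpos
  obtain ⟨B, hB, hlt⟩ : ∃ B, ∃ _ : B ∈ Admissible h, ⊥ < condLogLik g B z := by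
    simpa only [profileLogLik, lt_iSup_iff] using h1
  rw [condLogLik_eq_log_lik hB.1, bot_lt_iff_ne_bot, Ne, ENNReal.log_eq_bot_iff,
    ENNReal.ofReal_eq_zero, not_le] at hlt
  -- The factor of group `t` at the node `z t`, where `B` has entry 1.
  have h2 := Finset.prod_ne_zero_iff.1 (Finset.prod_ne_zero_iff.1 hlt.ne' t (Finset.mem_univ _))
    (Fin.castLE h (z t)) (Finset.mem_univ _)
  rw [hB.2] at h2
  by_contra hg
  simp [bern, hg] at h2

/-- A maximizer of the profile likelihood beats any `(A, z₀)` at some grid matrix. -/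
theorem IsMaxProfile.exists_gridMatrix {nL n T : ℕ} {h : nL ≤ n} {g : Fin T → Fin n → Bool}
    {z : Fin T → Fin nL} (hz : IsMaxProfile h g z) {A : Matrix (Fin nL) (Fin n) ℝ}
    (hA : A ∈ Admissible h) (z₀ : Fin T → Fin nL) :
    ∃ K : Fin nL → Fin n → Fin (T + 1), lik g A z₀ ≤ lik g (gridMatrix z K) z := by
  obtain ⟨K, hK⟩ := exists_gridMatrix_lik_ge g z
  refine ⟨K, ?_⟩
  have h1 : condLogLik g A z₀ ≤ condLogLik g (gridMatrix z K) z := by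
    -- The grid matrix is optimal among all matrices with entries in [0, 1], so it need not be
    -- admissible itself.
    refine ((le_iSup₂ (f := fun A _ => condLogLik g A z₀) A hA).trans (hz z₀)).trans
      (iSup₂_le fun B hB => ?_)
    rw [condLogLik_eq_log_lik hB.1, condLogLik_eq_log_lik (gridMatrix_mem z K)]
    exact ENNReal.log_monotone (ENNReal.ofReal_le_ofReal (hK B hB.1))
  rw [condLogLik_eq_log_lik hA.1, condLogLik_eq_log_lik (gridMatrix_mem z K),
    ENNReal.log_le_log_iff] at h1
  exact (ENNReal.ofReal_le_ofReal_iff (lik_nonneg (gridMatrix_mem z K) _ _)).1 h1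

/-! ### Likelihood ratios for a fixed matrix and assignment. -/

/-- The Hellinger affinity of two Bernoulli laws. -/
theorem sum_sqrt_bern_mul_bern_le {p q : ℝ} (hp : p ∈ Set.Icc (0 : ℝ) 1)
    (hq : q ∈ Set.Icc (0 : ℝ) 1) :
    ∑ b : Bool, √(bern p b * bern q b) ≤ Real.exp (-((p - q) ^ 2 / 8)) := by
  obtain ⟨hp0, hp1⟩ := hp
  obtain ⟨hq0, hq1⟩ := hq
  have e1 := Real.sq_sqrt hp0
  have e2 := Real.sq_sqrt hq0
  have e3 := Real.sq_sqrt (sub_nonneg.2 hp1)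
  have e4 := Real.sq_sqrt (sub_nonneg.2 hq1)
  have l1 : √p ≤ 1 := Real.sqrt_le_one.2 hp1
  have l2 : √q ≤ 1 := Real.sqrt_le_one.2 hq1
  have n1 := Real.sqrt_nonneg p
  have n2 := Real.sqrt_nonneg q
  have hsum : ∑ b : Bool, √(bern p b * bern q b) = √p * √q + √(1 - p) * √(1 - q) := by
    simp [bern, Real.sqrt_mul hp0, Real.sqrt_mul (sub_nonneg.2 hp1)]
  have hdiff : (p - q) ^ 2 = (√p - √q) ^ 2 * (√p + √q) ^ 2 := by
    rw [← mul_pow, ← e1, ← e2, Real.sqrt_sq n1, Real.sqrt_sq n2]; ring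
  -- Here √p + √q ≤ 2. One minus the affinity is half of (√p - √q)² + (√(1-p) - √(1-q))², hence at
  -- least (p - q)²/8.
  have hle : (p - q) ^ 2 ≤ 4 * (√p - √q) ^ 2 := by
    rw [hdiff, mul_comm]
    exact mul_le_mul_of_nonneg_right (by nlinarith) (sq_nonneg _)
  rw [hsum]
  refine le_trans ?_ (Real.add_one_le_exp _)
  nlinarith [sq_nonneg (√(1 - p) - √(1 - q))]

theorem sum_prod_prod_bool {n T : ℕ} (F : Fin T → Fin n → Bool → ℝ) :
    ∑ g : Fin T → Fin n → Bool, ∏ t, ∏ j, F t j (g t j) = ∏ t, ∏ j, ∑ b, F t j b := by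
  simp only [Finset.prod_univ_sum, Fintype.piFinset_univ]

/-- Chernoff bound for the likelihood ratio of two Bernoulli matrices. -/
theorem sum_lik_le_exp {nL n T : ℕ} {A B : Matrix (Fin nL) (Fin n) ℝ}
    (hA : ∀ i j, A i j ∈ Set.Icc (0 : ℝ) 1) (hB : ∀ i j, B i j ∈ Set.Icc (0 : ℝ) 1)
    (z₀ z : Fin T → Fin nL) :
    ∑ g : Fin T → Fin n → Bool, (if lik g A z₀ ≤ lik g B z then lik g A z₀ else 0)
      ≤ Real.exp (-(∑ t, ∑ j, (A (z₀ t) j - B (z t) j) ^ 2) / 8) := by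
  -- If a ≤ b then a ≤ √(ab). The root of the product of likelihoods factorizes over all entries,
  -- and each factor sums to an affinity.
  calc _ ≤ ∑ g : Fin T → Fin n → Bool,
        ∏ t, ∏ j, √(bern (A (z₀ t) j) (g t j) * bern (B (z t) j) (g t j)) := by
        refine Finset.sum_le_sum fun g _ => ?_
        have hs : ∏ t, ∏ j, √(bern (A (z₀ t) j) (g t j) * bern (B (z t) j) (g t j))
            = √(lik g A z₀ * lik g B z) := by
          simp only [lik, ← Finset.prod_mul_distrib]
          have hnn : ∀ t j, 0 ≤ bern (A (z₀ t) j) (g t j) * bern (B (z t) j) (g t j) :=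
            fun t j => mul_nonneg (bern_nonneg (hA _ _) _) (bern_nonneg (hB _ _) _)
          refine (Real.sqrt_eq_iff_mul_self_eq (Finset.prod_nonneg fun t _ =>
            Finset.prod_nonneg fun j _ => hnn t j)
            (Finset.prod_nonneg fun t _ => Finset.prod_nonneg fun j _ => Real.sqrt_nonneg _)).2 ?_
            |>.symm
          simp only [← Finset.prod_mul_distrib]
          exact Finset.prod_congr rfl fun t _ => Finset.prod_congr rfl fun j _ =>
            (Real.mul_self_sqrt (hnn t j)).symm
        rw [hs]
        split_ifs with hle
        · refine Real.le_sqrt_of_sq_le ?_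
          rw [sq]
          exact mul_le_mul_of_nonneg_left hle (lik_nonneg hA _ _)
        · positivity
    _ = ∏ t, ∏ j, ∑ b : Bool, √(bern (A (z₀ t) j) b * bern (B (z t) j) b) :=
        sum_prod_prod_bool fun t j b => √(bern (A (z₀ t) j) b * bern (B (z t) j) b)
    _ ≤ ∏ t, ∏ j, Real.exp (-((A (z₀ t) j - B (z t) j) ^ 2 / 8)) := by
        refine Finset.prod_le_prod (fun t _ => Finset.prod_nonneg fun j _ =>
          Finset.sum_nonneg fun b _ => Real.sqrt_nonneg _) fun t _ => Finset.prod_le_prod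
          (fun j _ => Finset.sum_nonneg fun b _ => Real.sqrt_nonneg _) fun j _ =>
          sum_sqrt_bern_mul_bern_le (hA _ _) (hB _ _)
    _ = _ := by
        simp only [← Real.exp_sum, Finset.sum_neg_distrib, ← Finset.sum_div, neg_div]

/-- Each row `i` of `B` is close to the row of `A` of at most one hub, `f i`. -/
theorem exists_sum_sq_ge {nL n T : ℕ} {P : Params nL n} {d v : ℝ} (hd : 0 < d)
    (hsep : Separated P d v) (B : Matrix (Fin nL) (Fin n) ℝ) (z₀ z : Fin T → Fin nL) :
    ∃ f : Fin nL → Fin nL, d ^ 2 * v * n / (4 * nL) *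
      (Finset.univ.filter fun t => z₀ t ≠ f (z t)).card
        ≤ ∑ t, ∑ j, (P.A (z₀ t) j - B (z t) j) ^ 2 := by
  obtain ⟨V, hV⟩ := hsep
  -- If two rows of A were both within η of a row of B, then x² + y² ≥ (x - y)²/2 on `V k` would
  -- give a total of at least (vn/n_L)(d²/2) = 2η.
  set η : ℝ := d ^ 2 * v * n / (4 * nL) with hη
  have hpair : ∀ i k k', k ≠ k' → ¬ (∑ j, (P.A k j - B i j) ^ 2 < η ∧
      ∑ j, (P.A k' j - B i j) ^ 2 < η) := by
    rintro i k k' hk ⟨h1, h2⟩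
    have h3 : ∑ j ∈ V k, d ^ 2 / 2 ≤
        ∑ j ∈ V k, ((P.A k j - B i j) ^ 2 + (P.A k' j - B i j) ^ 2) := by
      refine Finset.sum_le_sum fun j hj => ?_
      have := (hV k).2 j hj k' hk
      have h4 : d ^ 2 ≤ (P.A k j - P.A k' j) ^ 2 := pow_le_pow_left₀ hd.le this 2
      nlinarith [sq_nonneg (P.A k j - B i j + (P.A k' j - B i j))]
    have h5 := h3.trans (Finset.sum_le_sum_of_subset_of_nonneg (Finset.subset_univ _)
      fun j _ _ => by positivity)
    rw [Finset.sum_const, nsmul_eq_mul, Finset.sum_add_distrib] at h5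
    have h6 : v * n / nL * (d ^ 2 / 2) ≤ (V k).card * (d ^ 2 / 2) :=
      mul_le_mul_of_nonneg_right (hV k).1 (by positivity)
    have h7 : v * n / nL * (d ^ 2 / 2) = 2 * η := by rw [hη]; ring
    linarith
  have hf : ∀ i, ∃ k, ∀ k', k' ≠ k → η ≤ ∑ j, (P.A k' j - B i j) ^ 2 := by
    intro i
    by_cases hc : ∃ k, ∑ j, (P.A k j - B i j) ^ 2 < η
    · obtain ⟨k, hk⟩ := hc
      exact ⟨k, fun k' hk' => not_lt.1 fun hlt => hpair i k' k hk' ⟨hlt, hk⟩⟩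
    · push Not at hc
      -- No row of A is near, so any label serves here.
      exact ⟨i, fun k' _ => hc k'⟩
  choose f hf using hf
  refine ⟨f, ?_⟩
  calc η * (Finset.univ.filter fun t => z₀ t ≠ f (z t)).card
      = ∑ t ∈ Finset.univ.filter fun t => z₀ t ≠ f (z t), η := by
        rw [Finset.sum_const, nsmul_eq_mul, mul_comm]
    _ ≤ ∑ t ∈ Finset.univ.filter fun t => z₀ t ≠ f (z t),
        ∑ j, (P.A (z₀ t) j - B (z t) j) ^ 2 :=
        Finset.sum_le_sum fun t ht => hf _ _ (Finset.mem_filter.1 ht).2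
    _ ≤ _ := Finset.sum_le_sum_of_subset_of_nonneg (Finset.subset_univ _)
        fun t _ _ => Finset.sum_nonneg fun j _ => sq_nonneg _

/-! ### The law of the sample as a finite sum. -/

/-- The probability of the pair (hub, group) `y`. -/
def weight {nL n : ℕ} (P : Params nL n) (y : Fin nL × (Fin n → Bool)) : ℝ :=
  P.ρ y.1 * ∏ j, bern (P.A y.1 j) (y.2 j)

theorem weight_nonneg {nL n : ℕ} (P : Params nL n) (y : Fin nL × (Fin n → Bool)) :
    0 ≤ weight P y :=
  mul_nonneg (P.ρ_nonneg _) (Finset.prod_nonneg fun _ _ => bern_nonneg (P.A_mem.1 _ _) _)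

theorem sum_bern (p : ℝ) : ∑ b : Bool, bern p b = 1 := by simp [bern]

theorem sum_prod_bern {n : ℕ} (p : Fin n → ℝ) :
    ∑ g : Fin n → Bool, ∏ j, bern (p j) (g j) = 1 := by
  have := Finset.prod_univ_sum (fun _ : Fin n => (Finset.univ : Finset Bool))
    (fun j b => bern (p j) b)
  rw [Fintype.piFinset_univ] at this
  rw [← this]
  simp only [sum_bern, Finset.prod_const_one]

theorem sum_weight {nL n : ℕ} (P : Params nL n) : ∑ y, weight P y = 1 := by
  simp only [weight, Fintype.sum_prod_type, ← Finset.mul_sum, sum_prod_bern, mul_one, P.ρ_sum]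

/-- The restriction `g i = b` involves a single coordinate, so it can be moved into the `i`-th
factor; the sum still factorizes and all other factors sum to 1. -/
theorem sum_prod_bern_of_eq {n : ℕ} (p : Fin n → ℝ) (i : Fin n) (b : Bool) :
    ∑ g : Fin n → Bool, (if g i = b then ∏ j, bern (p j) (g j) else 0) = bern (p i) b := by
  have h := Finset.prod_univ_sum (fun _ : Fin n => (Finset.univ : Finset Bool))
    (fun j c => if j = i → c = b then bern (p j) c else 0)
  rw [Fintype.piFinset_univ] at h
  have h1 : ∀ g : Fin n → Bool, (∏ j, if j = i → g j = b then bern (p j) (g j) else 0)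
      = if g i = b then ∏ j, bern (p j) (g j) else 0 := by
    intro g
    split_ifs with hg
    · refine Finset.prod_congr rfl fun j _ => if_pos ?_
      rintro rfl
      exact hg
    · exact Finset.prod_eq_zero (Finset.mem_univ i) (if_neg fun hc => hg (hc rfl))
  simp only [h1] at h
  rw [← h, Finset.prod_eq_single i]
  · cases b <;> simp
  · intro j _ hj
    simpa only [hj, false_implies, if_true] using sum_bern (p j)
  · simp

/-- The probability that the hub is `k` and the membership of node `i` is `b`. -/
theorem sum_indicator_weight {nL n : ℕ} (P : Params nL n) (k : Fin nL) (i : Fin n) (b : Bool) :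
    ∑ y, {y : Fin nL × (Fin n → Bool) | y.1 = k ∧ y.2 i = b}.indicator (weight P) y
      = P.ρ k * bern (P.A k i) b := by
  classical
  rw [Fintype.sum_prod_type, Finset.sum_eq_single k]
  · rw [← sum_prod_bern_of_eq (P.A k), Finset.mul_sum]
    refine Finset.sum_congr rfl fun g _ => ?_
    simp [Set.indicator_apply, weight]
  · intro k' _ hk
    simp [hk]
  · simp

/-- The probability that a sample of `T` groups with their hubs lies in `S`. -/
def sampleProb {nL n : ℕ} (P : Params nL n) {T : ℕ}
    (S : Set (Fin T → Fin nL × (Fin n → Bool))) : ℝ :=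
  ∑ x, S.indicator (fun x => ∏ t, weight P (x t)) x

section sampleProb

variable {nL n T : ℕ} (P : Params nL n)

theorem prod_weight_nonneg (x : Fin T → Fin nL × (Fin n → Bool)) : 0 ≤ ∏ t, weight P (x t) :=
  Finset.prod_nonneg fun _ _ => weight_nonneg P _

theorem sampleProb_mono {S S' : Set (Fin T → Fin nL × (Fin n → Bool))} (h : S ⊆ S') :
    sampleProb P S ≤ sampleProb P S' :=
  Finset.sum_le_sum fun x _ =>
    Set.indicator_le_indicator_of_subset h (fun x => prod_weight_nonneg P x) x

theorem sampleProb_union_le (S S' : Set (Fin T → Fin nL × (Fin n → Bool))) :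
    sampleProb P (S ∪ S') ≤ sampleProb P S + sampleProb P S' := by
  classical
  rw [sampleProb, sampleProb, sampleProb, ← Finset.sum_add_distrib]
  refine Finset.sum_le_sum fun x _ => ?_
  have := prod_weight_nonneg P x
  by_cases h : x ∈ S <;> by_cases h' : x ∈ S' <;> simp [h, h', this]

theorem sampleProb_iUnion_le {κ : Type*} [Fintype κ]
    (S : κ → Set (Fin T → Fin nL × (Fin n → Bool))) :
    sampleProb P (⋃ a, S a) ≤ ∑ a, sampleProb P (S a) := by
  classical
  simp only [sampleProb]
  rw [Finset.sum_comm]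
  refine Finset.sum_le_sum fun x _ => ?_
  have hnn : ∀ a, 0 ≤ (S a).indicator (fun x => ∏ t, weight P (x t)) x := fun a =>
    Set.indicator_nonneg (fun x _ => prod_weight_nonneg P x) x
  by_cases h : x ∈ ⋃ a, S a
  · obtain ⟨a, ha⟩ := Set.mem_iUnion.1 h
    rw [Set.indicator_of_mem h]
    refine le_trans ?_ (Finset.single_le_sum (fun a _ => hnn a) (Finset.mem_univ a))
    rw [Set.indicator_of_mem ha]
  · rw [Set.indicator_of_notMem h]
    exact Finset.sum_nonneg fun a _ => hnn a

open Classical in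
/-- Exponential moments of the number of groups in `Q`. -/
theorem sum_weight_mul_exp_count_le (Q : Set (Fin nL × (Fin n → Bool))) (s : ℝ) :
    ∑ x : Fin T → Fin nL × (Fin n → Bool),
      (∏ t, weight P (x t)) * Real.exp (s * (Finset.univ.filter fun t => x t ∈ Q).card)
      ≤ Real.exp (T * ((Real.exp s - 1) * ∑ y, Q.indicator (weight P) y)) := by
  have h1 : ∀ x : Fin T → Fin nL × (Fin n → Bool),
      (∏ t, weight P (x t)) * Real.exp (s * (Finset.univ.filter fun t => x t ∈ Q).card)
      = ∏ t, weight P (x t) * (if x t ∈ Q then Real.exp s else 1) := by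
    intro x
    rw [Finset.prod_mul_distrib, Finset.prod_ite, Finset.prod_const, Finset.prod_const_one, mul_one,
      mul_comm s, Real.exp_nat_mul]
  simp only [h1]
  rw [← Fintype.sum_pow (fun y => weight P y * (if y ∈ Q then Real.exp s else 1)),
    Real.exp_nat_mul]
  refine pow_le_pow_left₀ (Finset.sum_nonneg fun y _ => mul_nonneg (weight_nonneg P y)
    (by split_ifs <;> positivity)) ?_ _
  refine le_trans (le_of_eq ?_) (Real.add_one_le_exp _)
  have h2 : ∀ y, weight P y * (if y ∈ Q then Real.exp s else 1)
      = (Real.exp s - 1) * Q.indicator (weight P) y + weight P y := by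
    intro y
    rw [Set.indicator_apply]
    split_ifs <;> ring
  rw [Finset.sum_congr rfl fun y _ => h2 y, Finset.sum_add_distrib, Finset.mul_sum, sum_weight]

theorem sampleProb_le_sum {S : Set (Fin T → Fin nL × (Fin n → Bool))}
    (φ : (Fin T → Fin nL × (Fin n → Bool)) → ℝ) (h0 : ∀ x, 0 ≤ φ x) (h1 : ∀ x ∈ S, 1 ≤ φ x) :
    sampleProb P S ≤ ∑ x, (∏ t, weight P (x t)) * φ x := by
  refine Finset.sum_le_sum fun x _ => ?_
  by_cases hx : x ∈ S
  · rw [Set.indicator_of_mem hx]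
    exact le_mul_of_one_le_right (prod_weight_nonneg P x) (h1 x hx)
  · rw [Set.indicator_of_notMem hx]
    exact mul_nonneg (prod_weight_nonneg P x) (h0 x)

open Classical in
/-- Upper tail of the number of groups in `Q`. -/
theorem sampleProb_count_gt_le (Q : Set (Fin nL × (Fin n → Bool))) {M : ℝ}
    (hM : T * ∑ y, Q.indicator (weight P) y ≤ M) :
    sampleProb P {x : Fin T → Fin nL × (Fin n → Bool) |
      3 * M < (Finset.univ.filter fun t => x t ∈ Q).card} ≤ Real.exp (-M) := by
  have hnn : 0 ≤ T * ∑ y, Q.indicator (weight P) y := mul_nonneg (Nat.cast_nonneg _)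
    (Finset.sum_nonneg fun y _ => Set.indicator_nonneg (fun y _ => weight_nonneg P y) y)
  refine (sampleProb_le_sum P (fun x => Real.exp (-(3 * M)) *
    Real.exp (1 * (Finset.univ.filter fun t => x t ∈ Q).card)) (fun x => by positivity)
    fun x hx => ?_).trans ?_
  · rw [← Real.exp_add]
    refine Real.one_le_exp ?_
    have : 3 * M < ((Finset.univ.filter fun t => x t ∈ Q).card : ℝ) := hx
    linarith
  · have h := sum_weight_mul_exp_count_le (T := T) P Q 1
    simp only [mul_left_comm _ (Real.exp (-(3 * M))), ← Finset.mul_sum]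
    refine (mul_le_mul_of_nonneg_left h (Real.exp_nonneg _)).trans ?_
    rw [← Real.exp_add, Real.exp_le_exp]
    -- Markov's inequality at s = 1: the exponent is at most -3M + (e - 1)M, and e - 1 < 2.
    have := Real.exp_one_lt_d9
    nlinarith

open Classical in
/-- Lower tail of the number of groups in `Q`. -/
theorem sampleProb_count_le_le (Q : Set (Fin nL × (Fin n → Bool))) {M : ℝ}
    (hM : M ≤ T * ∑ y, Q.indicator (weight P) y) :
    sampleProb P {x : Fin T → Fin nL × (Fin n → Bool) |
      ((Finset.univ.filter fun t => x t ∈ Q).card : ℝ) ≤ M / 4} ≤ Real.exp (-(M / 4)) := by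
  have hnn : 0 ≤ T * ∑ y, Q.indicator (weight P) y := mul_nonneg (Nat.cast_nonneg _)
    (Finset.sum_nonneg fun y _ => Set.indicator_nonneg (fun y _ => weight_nonneg P y) y)
  refine (sampleProb_le_sum P (fun x => Real.exp (M / 4) *
    Real.exp (-1 * (Finset.univ.filter fun t => x t ∈ Q).card)) (fun x => by positivity)
    fun x hx => ?_).trans ?_
  · rw [← Real.exp_add]
    refine Real.one_le_exp ?_
    have : ((Finset.univ.filter fun t => x t ∈ Q).card : ℝ) ≤ M / 4 := hx
    linarith
  · have h := sum_weight_mul_exp_count_le (T := T) P Q (-1)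
    simp only [mul_left_comm _ (Real.exp (M / 4)), ← Finset.mul_sum]
    refine (mul_le_mul_of_nonneg_left h (Real.exp_nonneg _)).trans ?_
    rw [← Real.exp_add, Real.exp_le_exp]
    -- Markov's inequality at s = -1: the exponent is at most M/4 - (1 - 1/e)M with 1 - 1/e > 1/2.
    have := Real.exp_neg_one_lt_half
    nlinarith

/-- Conditioning on the true hubs: the Chernoff bound, which needs a deterministic `z₀`, applies to
each inner sum. -/
theorem sampleProb_eq_sum_sum (S : Set (Fin T → Fin nL × (Fin n → Bool))) :
    sampleProb P S = ∑ z : Fin T → Fin nL, (∏ t, P.ρ (z t)) *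
      ∑ g : Fin T → Fin n → Bool,
        {g | (fun t => (z t, g t)) ∈ S}.indicator (fun g => lik g P.A z) g := by
  classical
  rw [sampleProb, ← (Equiv.arrowProdEquivProdArrow (Fin T) (fun _ => Fin nL)
    (fun _ => Fin n → Bool)).symm.sum_comp, Fintype.sum_prod_type]
  refine Finset.sum_congr rfl fun z _ => ?_
  rw [Finset.mul_sum]
  refine Finset.sum_congr rfl fun g _ => ?_
  simp only [Set.indicator_apply, Set.mem_ofPred_eq, mul_ite, mul_zero, weight, lik,
    Finset.prod_mul_distrib, Equiv.arrowProdEquivProdArrow, Equiv.coe_fn_symm_mk]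

/-- The probability that the likelihood at `(B, z)` exceeds the true one, for a `z` that is at
distance at least `D` from all relabelings of the true hubs. -/
theorem sampleProb_lik_le {d v : ℝ} (hd : 0 < d) (hv : 0 < v) (hsep : Separated P d v)
    {B : Matrix (Fin nL) (Fin n) ℝ} (hB : ∀ i j, B i j ∈ Set.Icc (0 : ℝ) 1)
    (z : Fin T → Fin nL) (D : ℝ) :
    sampleProb P {x : Fin T → Fin nL × (Fin n → Bool) |
      (∀ f : Fin nL → Fin nL, D ≤ (Finset.univ.filter fun t => (x t).1 ≠ f (z t)).card) ∧
        lik (fun t => (x t).2) P.A (fun t => (x t).1) ≤ lik (fun t => (x t).2) B z}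
      ≤ Real.exp (-(d ^ 2 * v * n / (32 * nL) * D)) := by
  classical
  rw [sampleProb_eq_sum_sum]
  have hρ : ∑ z : Fin T → Fin nL, ∏ t, P.ρ (z t) = 1 := by
    rw [← Fintype.sum_pow, P.ρ_sum, one_pow]
  calc _ ≤ ∑ z : Fin T → Fin nL, (∏ t, P.ρ (z t)) *
        Real.exp (-(d ^ 2 * v * n / (32 * nL) * D)) := by
        refine Finset.sum_le_sum fun z₀ _ => mul_le_mul_of_nonneg_left ?_
          (Finset.prod_nonneg fun t _ => P.ρ_nonneg _)
        by_cases hf : ∀ f : Fin nL → Fin nL,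
            D ≤ (Finset.univ.filter fun t => z₀ t ≠ f (z t)).card
        · simp only [Set.mem_ofPred_eq, Set.indicator_apply, hf, implies_true, true_and]
          refine (sum_lik_le_exp P.A_mem.1 hB z₀ z).trans (Real.exp_le_exp.2 ?_)
          obtain ⟨f, hle⟩ := exists_sum_sq_ge hd hsep B z₀ z
          have h1 : d ^ 2 * v * n / (4 * nL) * D ≤ _ :=
            (mul_le_mul_of_nonneg_left (hf f) (by positivity)).trans hle
          have h2 : d ^ 2 * v * n / (32 * nL) * D = d ^ 2 * v * n / (4 * nL) * D / 8 := by ring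
          rw [h2]
          linarith
        · simp only [Set.mem_ofPred_eq, hf, false_and, Set.ofPred_false, Set.indicator_empty,
            Finset.sum_const_zero]
          positivity
    _ = _ := by rw [← Finset.sum_mul, hρ, one_mul]

/-- The sample takes finitely many values, so events about it have elementary probabilities, and the
union bound can be done with finite sums. -/
theorem IsSample.measureReal_eq {P : Params nL n} {Ω : Type*} [MeasurableSpace Ω] {μ : Measure Ω}
    [IsProbabilityMeasure μ] {zs : Ω → Fin T → Fin nL} {G : Ω → Fin T → Fin n → Bool}
    (hs : IsSample P μ zs G) (S : Set (Fin T → Fin nL × (Fin n → Bool))) :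
    μ.real {ω | (fun t => (zs ω t, G ω t)) ∈ S} = sampleProb P S := by
  classical
  set X : Ω → Fin T → Fin nL × (Fin n → Bool) := fun ω t => (zs ω t, G ω t) with hX
  have hXt : ∀ t, Measurable fun ω => X ω t := fun t =>
    ((measurable_pi_apply t).comp hs.measurable_zs).prodMk
      ((measurable_pi_apply t).comp hs.measurable_G)
  have hXm : Measurable X := measurable_pi_lambda _ hXt
  have hpt : ∀ x, μ.real (X ⁻¹' {x}) = ∏ t, weight P (x t) := by
    intro x
    have h1 : X ⁻¹' {x} = ⋂ t ∈ (Finset.univ : Finset (Fin T)), (fun ω => X ω t) ⁻¹' {x t} := by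
      ext ω
      simp [funext_iff]
    have h2 := hs.indep.measure_inter_preimage_eq_mul Finset.univ (sets := fun t => {x t})
      fun t _ => measurableSet_singleton _
    rw [h1, measureReal_def, h2, ENNReal.toReal_prod]
    refine Finset.prod_congr rfl fun t _ => ?_
    rw [weight, ← hs.law t, measureReal_def]
    congr 2
    ext ω
    simp [Prod.ext_iff]
  have h3 : {ω | X ω ∈ S} = X ⁻¹' ((Finset.univ.filter fun x => x ∈ S : Finset _) : Set _) := by
    ext ω
    simp
  rw [h3, ← sum_measureReal_preimage_singleton _ fun x _ => hXm (measurableSet_singleton x),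
    Finset.sum_filter, sampleProb]
  refine Finset.sum_congr rfl fun x _ => ?_
  rw [hpt, Set.indicator_apply]

end sampleProb

/-! ### The union bound. -/

/-- If every misclassifying feasible assignment is, on the event `S`, at distance at least `D` from
all relabelings of the true hubs, then misclassification is unlikely. -/
theorem IsSample.measure_numErrors_le {nL n T : ℕ} {P : Params nL n} {Ω : Type*}
    [MeasurableSpace Ω] {μ : Measure Ω} [IsProbabilityMeasure μ] {zs : Ω → Fin T → Fin nL}
    {G : Ω → Fin T → Fin n → Bool} (hs : IsSample P μ zs G) {zhat : Ω → Fin T → Fin nL}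
    (hzhat : ∀ᵐ ω ∂μ, IsMaxProfile P.le (G ω) (zhat ω)) {d v : ℝ} (hd : 0 < d) (hv : 0 < v)
    (hsep : Separated P d v) (S : Set (Fin T → Fin nL × (Fin n → Bool))) (ε D : ℝ)
    (hS : ∀ x ∈ S, ∀ z : Fin T → Fin nL, (∀ t, (x t).2 (Fin.castLE P.le (z t)) = true) →
      ε ≤ (numErrors (fun t => (x t).1) z : ℝ) / T →
      ∀ f : Fin nL → Fin nL, D ≤ (Finset.univ.filter fun t => (x t).1 ≠ f (z t)).card) :
    μ {ω | ε ≤ (numErrors (zs ω) (zhat ω) : ℝ) / T} ≤ ENNReal.ofReal (sampleProb P Sᶜ +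
      (nL : ℝ) ^ T * (T + 1 : ℝ) ^ (nL * n) * Real.exp (-(d ^ 2 * v * n / (32 * nL) * D))) := by
  classical
  let E : (Fin T → Fin nL) × (Fin nL → Fin n → Fin (T + 1)) →
      Set (Fin T → Fin nL × (Fin n → Bool)) := fun q => {x |
      (∀ f : Fin nL → Fin nL, D ≤ (Finset.univ.filter fun t => (x t).1 ≠ f (q.1 t)).card) ∧
        lik (fun t => (x t).2) P.A (fun t => (x t).1) ≤
          lik (fun t => (x t).2) (gridMatrix q.1 q.2) q.1}
  -- Feasibility of the maximizer needs a positive true likelihood; the exceptional set has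
  -- probability zero.
  let N : Set (Fin T → Fin nL × (Fin n → Bool)) :=
    {x | lik (fun t => (x t).2) P.A (fun t => (x t).1) = 0}
  have hN : sampleProb P N = 0 := by
    refine Finset.sum_eq_zero fun x _ => ?_
    by_cases hx : x ∈ N
    · rw [Set.indicator_of_mem hx]
      have : ∏ t, weight P (x t) = (∏ t, P.ρ (x t).1) *
          lik (fun t => (x t).2) P.A (fun t => (x t).1) := by
        simp only [weight, lik, Finset.prod_mul_distrib]
      rw [this, show lik (fun t => (x t).2) P.A (fun t => (x t).1) = 0 from hx, mul_zero]
    · exact Set.indicator_of_notMem hx _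
  have hE : sampleProb P (⋃ q, E q) ≤ (nL : ℝ) ^ T * (T + 1 : ℝ) ^ (nL * n) *
      Real.exp (-(d ^ 2 * v * n / (32 * nL) * D)) := by
    refine (sampleProb_iUnion_le P E).trans ((Finset.sum_le_sum fun q _ =>
      sampleProb_lik_le P hd hv hsep (gridMatrix_mem q.1 q.2) q.1 D).trans_eq ?_)
    rw [Finset.sum_const, nsmul_eq_mul, Finset.card_univ]
    simp only [Fintype.card_prod, Fintype.card_pi, Fintype.card_fin, Finset.prod_const,
      Finset.card_univ]
    push_cast
    rw [← pow_mul, mul_comm n nL]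
  have hsub : ∀ᵐ ω ∂μ, ω ∈ {ω | ε ≤ (numErrors (zs ω) (zhat ω) : ℝ) / T} →
      ω ∈ {ω | (fun t => (zs ω t, G ω t)) ∈ Sᶜ ∪ (N ∪ ⋃ q, E q)} := by
    filter_upwards [hzhat] with ω hω herr
    by_cases hxS : (fun t => (zs ω t, G ω t)) ∈ S
    swap
    · exact Or.inl hxS
    refine Or.inr ?_
    by_cases hpos : lik (G ω) P.A (zs ω) = 0
    · exact Or.inl hpos
    have hpos' : 0 < lik (G ω) P.A (zs ω) :=
      lt_of_le_of_ne (lik_nonneg P.A_mem.1 _ _) (Ne.symm hpos)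
    obtain ⟨K, hK⟩ := hω.exists_gridMatrix P.A_mem (zs ω)
    exact Or.inr (Set.mem_iUnion.2 ⟨(zhat ω, K),
      hS _ hxS (zhat ω) (fun t => hω.feasible P.A_mem hpos' t) herr, hK⟩)
  -- The covering event involves only the sample, so no measurability of `zhat` is needed.
  refine (measure_mono_ae (t := {ω | (fun t => (zs ω t, G ω t)) ∈ Sᶜ ∪ (N ∪ ⋃ q, E q)})
    hsub).trans ?_
  rw [← ofReal_measureReal, hs.measureReal_eq]
  refine ENNReal.ofReal_le_ofReal ?_
  have h1 := sampleProb_union_le P Sᶜ (N ∪ ⋃ q, E q)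
  have h2 := sampleProb_union_le P N (⋃ q, E q)
  linarith

/-! ### Hub memberships in typical samples. -/

section typical

variable {nL n T : ℕ}

/-- The pairs (hub, group) in which the hub is `k` and the membership of hub `i` is `b`. -/
def hubEvent (h : nL ≤ n) (b : Bool) (k i : Fin nL) : Set (Fin nL × (Fin n → Bool)) :=
  {y | y.1 = k ∧ y.2 (Fin.castLE h i) = b}

open Classical in
/-- The number of groups with hub `k` in which the membership of hub `i` is `b`. -/
def hubCount (h : nL ≤ n) (b : Bool) (x : Fin T → Fin nL × (Fin n → Bool)) (k i : Fin nL) : ℕ :=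
  (Finset.univ.filter fun t => x t ∈ hubEvent h b k i).card

theorem sampleProb_forall_ne_compl_le (P : Params nL n)
    (S : Fin nL → Fin nL → Set (Fin T → Fin nL × (Fin n → Bool))) {r : ℝ} (hr : 0 ≤ r)
    (h : ∀ k i, k ≠ i → sampleProb P (S k i)ᶜ ≤ r) :
    sampleProb P {x | ∀ k i, k ≠ i → x ∈ S k i}ᶜ ≤ (nL : ℝ) ^ 2 * r := by
  let E : Fin nL × Fin nL → Set (Fin T → Fin nL × (Fin n → Bool)) :=
    fun p => {x | p.1 ≠ p.2 ∧ x ∈ (S p.1 p.2)ᶜ}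
  have hsub : {x | ∀ k i, k ≠ i → x ∈ S k i}ᶜ ⊆ ⋃ p, E p := by
    intro x hx
    have hx' : ¬ ∀ k i, k ≠ i → x ∈ S k i := hx
    push Not at hx'
    obtain ⟨k, i, hki, hxS⟩ := hx'
    exact Set.mem_iUnion.2 ⟨(k, i), hki, hxS⟩
  refine (sampleProb_mono P hsub).trans ((sampleProb_iUnion_le P E).trans ?_)
  refine (Finset.sum_le_card_nsmul _ _ r fun p _ => ?_).trans_eq ?_
  · by_cases hp : p.1 = p.2
    · have : E p = ∅ := Set.eq_empty_of_forall_notMem fun x hx => hx.1 hp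
      rw [this]
      simpa [sampleProb] using hr
    · exact (sampleProb_mono P fun x hx => hx.2).trans (h p.1 p.2 hp)
  · rw [nsmul_eq_mul, Finset.card_univ, Fintype.card_prod, Fintype.card_fin]
    push_cast
    ring

/-- Few groups contain a hub other than their own. -/
theorem sampleProb_hubCount_true (P : Params nL n) {M : ℝ}
    (hM : ∀ k i, k ≠ i → T * (P.ρ k * P.A k (Fin.castLE P.le i)) ≤ M) :
    sampleProb P {x : Fin T → Fin nL × (Fin n → Bool) |
      ∀ k i, k ≠ i → x ∈ {x | (hubCount P.le true x k i : ℝ) ≤ 3 * M}}ᶜ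
      ≤ (nL : ℝ) ^ 2 * Real.exp (-M) := by
  refine sampleProb_forall_ne_compl_le P
    (fun k i => {x | (hubCount P.le true x k i : ℝ) ≤ 3 * M}) (Real.exp_nonneg _)
    fun k i hki => ?_
  refine (sampleProb_mono P fun x hx => ?_).trans
    (sampleProb_count_gt_le P (hubEvent P.le true k i) (M := M) ?_)
  · have hx' : ¬ (hubCount P.le true x k i : ℝ) ≤ 3 * M := hx
    exact not_le.1 hx'
  · rw [hubEvent, sum_indicator_weight]
    simpa [bern] using hM k i hki

/-- Many groups with hub `k` do not contain the hub `i`. -/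
theorem sampleProb_hubCount_false (P : Params nL n) {M : ℝ}
    (hM : ∀ k i, k ≠ i → M ≤ T * (P.ρ k * (1 - P.A k (Fin.castLE P.le i)))) :
    sampleProb P {x : Fin T → Fin nL × (Fin n → Bool) |
      ∀ k i, k ≠ i → x ∈ {x | M / 4 < (hubCount P.le false x k i : ℝ)}}ᶜ
      ≤ (nL : ℝ) ^ 2 * Real.exp (-(M / 4)) := by
  refine sampleProb_forall_ne_compl_le P
    (fun k i => {x | M / 4 < (hubCount P.le false x k i : ℝ)}) (Real.exp_nonneg _)
    fun k i hki => ?_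
  refine (sampleProb_mono P fun x hx => ?_).trans
    (sampleProb_count_le_le P (hubEvent P.le false k i) (M := M) ?_)
  · have hx' : ¬ M / 4 < (hubCount P.le false x k i : ℝ) := hx
    exact not_lt.1 hx'
  · rw [hubEvent, sum_indicator_weight]
    simpa [bern] using hM k i hki

/-- An error at `t` with true hub `f (z t)` has i = z t with f i ≠ i, and the group contains i by
feasibility. For each i only the pair (f i, i) occurs, hence `nL` counts and not `nL ^ 2`. -/
theorem numErrors_le_of_hubCount_true_le {h : nL ≤ n} {x : Fin T → Fin nL × (Fin n → Bool)}
    {M : ℝ} (hM0 : 0 ≤ M) (hM : ∀ k i, k ≠ i → (hubCount h true x k i : ℝ) ≤ M)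
    {z : Fin T → Fin nL} (hz : ∀ t, (x t).2 (Fin.castLE h (z t)) = true)
    (f : Fin nL → Fin nL) :
    (numErrors (fun t => (x t).1) z : ℝ)
      ≤ (Finset.univ.filter fun t => (x t).1 ≠ f (z t)).card + nL * M := by
  classical
  have hsub : (Finset.univ.filter fun t => (x t).1 ≠ z t) ⊆
      (Finset.univ.filter fun t => (x t).1 ≠ f (z t)) ∪
        (Finset.univ.filter fun i => f i ≠ i).biUnion fun i =>
          Finset.univ.filter fun t => x t ∈ hubEvent h true (f i) i := by
    intro t ht
    simp only [Finset.mem_union, Finset.mem_filter, Finset.mem_univ, true_and,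
      Finset.mem_biUnion] at ht ⊢
    by_cases hc : (x t).1 = f (z t)
    · exact Or.inr ⟨z t, fun he => ht (hc.trans he), hc, hz t⟩
    · exact Or.inl hc
  have h1 := (Finset.card_le_card hsub).trans
    ((Finset.card_union_le _ _).trans (Nat.add_le_add_left Finset.card_biUnion_le _))
  have h2 : (numErrors (fun t => (x t).1) z : ℝ)
      ≤ (Finset.univ.filter fun t => (x t).1 ≠ f (z t)).card +
        ∑ i ∈ Finset.univ.filter (fun i => f i ≠ i), (hubCount h true x (f i) i : ℝ) := by
    exact_mod_cast h1
  refine h2.trans (add_le_add le_rfl ?_)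
  refine (Finset.sum_le_card_nsmul _ _ M fun i hi =>
    hM _ _ (Finset.mem_filter.1 hi).2).trans ?_
  rw [nsmul_eq_mul]
  refine mul_le_mul_of_nonneg_right ?_ hM0
  exact_mod_cast (Finset.card_le_univ _).trans_eq (Fintype.card_fin nL)

/-- Choose k ≠ i such that f takes the value k at most at i. A group with hub k that omits i cannot
be assigned to i, so f sends its label away from k. -/
theorem le_card_ne_of_lt_hubCount_false {h : nL ≤ n} (hnL : 2 ≤ nL)
    {x : Fin T → Fin nL × (Fin n → Bool)}
    {M : ℝ} (hM : ∀ k i, k ≠ i → M < (hubCount h false x k i : ℝ))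
    {z : Fin T → Fin nL} (hz : ∀ t, (x t).2 (Fin.castLE h (z t)) = true)
    (f : Fin nL → Fin nL) (hf : f ≠ id) :
    M ≤ (Finset.univ.filter fun t => (x t).1 ≠ f (z t)).card := by
  classical
  -- If f is a permutation, take i with k = f i ≠ i; otherwise take k outside the range of f and any
  -- other i.
  obtain ⟨k, i, hki, hkf⟩ : ∃ k i, k ≠ i ∧ ∀ i', i' ≠ i → f i' ≠ k := by
    by_cases hs : Function.Surjective f
    · have hinj : Function.Injective f := Finite.injective_iff_surjective.2 hs
      obtain ⟨i, hi⟩ := Function.ne_iff.1 hf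
      exact ⟨f i, i, hi, fun i' hi' he => hi' (hinj he)⟩
    · have hs' : ∃ k, ∀ i, f i ≠ k := by simpa [Function.Surjective] using hs
      obtain ⟨k, hk⟩ := hs'
      have : Nontrivial (Fin nL) := Fin.nontrivial_iff_two_le.2 hnL
      obtain ⟨i, hi⟩ := exists_ne k
      exact ⟨k, i, hi.symm, fun i' _ => hk i'⟩
  refine (hM k i hki).le.trans ?_
  refine Nat.cast_le.2 (Finset.card_le_card fun t ht => ?_)
  obtain ⟨h1, h2⟩ : (x t).1 = k ∧ (x t).2 (Fin.castLE h i) = false :=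
    (Finset.mem_filter.1 ht).2
  refine Finset.mem_filter.2 ⟨Finset.mem_univ _, fun he => hkf (z t) ?_ (he.symm.trans h1)⟩
  intro hzi
  have := hz t
  rw [hzi, h2] at this
  exact Bool.false_ne_true this

theorem Params.nL_pos (P : Params nL n) : 0 < nL := by
  rcases Nat.eq_zero_or_pos nL with rfl | h
  · have := P.ρ_sum
    simp at this
  · exact h

/-- Each `V i` is nonempty and has at most n elements. A second hub is needed for the margin `d` to
be a difference of two entries of A. -/
theorem Separated.bounds {P : Params nL n} {d v : ℝ} (hv : 0 < v) (hsep : Separated P d v)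
    (hnL : 2 ≤ nL) : d ≤ 1 ∧ v ≤ nL := by
  obtain ⟨V, hV⟩ := hsep
  have : Nontrivial (Fin nL) := Fin.nontrivial_iff_two_le.2 hnL
  obtain ⟨i, i', hii⟩ := exists_pair_ne (Fin nL)
  have ha : (0 : ℝ) < nL := by exact_mod_cast P.nL_pos
  have hn : (0 : ℝ) < n := by exact_mod_cast P.nL_pos.trans_le P.le
  constructor
  · have hpos : (0 : ℝ) < (V i).card := lt_of_lt_of_le (by positivity) (hV i).1
    obtain ⟨j, hj⟩ := Finset.card_pos.1 (by exact_mod_cast hpos)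
    have h1 := (hV i).2 j hj i' hii
    have h2 := (P.A_mem.1 i j).2
    have h3 := (P.A_mem.1 i' j).1
    linarith
  · have h1 : ((V i).card : ℝ) ≤ n := by
      exact_mod_cast (Finset.card_le_univ _).trans_eq (Fintype.card_fin n)
    have h2 := (hV i).1.trans h1
    rw [div_le_iff₀ ha, mul_comm (n : ℝ)] at h2
    exact le_of_mul_le_mul_right h2 hn

end typical

/-! ### Asymptotics. -/

section asymptotics

variable {ι : Type*} {l : Filter ι}

/-- The union bound over all assignments and grid matrices vanishes. -/
theorem tendsto_union_bound {a n T : ι → ℕ} {w : ι → ℝ} (ha : ∀ k, 0 < a k) (hw : ∀ k, 0 < w k)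
    {δ : ℝ} (hδ : 0 < δ) (hn : Tendsto n l atTop) (hT : Tendsto T l atTop)
    (h1 : Tendsto (fun k => (a k : ℝ) * Real.log (a k) / (w k * n k)) l (𝓝 0))
    (h2 : Tendsto (fun k => (a k : ℝ) ^ 2 * Real.log (T k) / (w k * T k)) l (𝓝 0)) :
    Tendsto (fun k => (a k : ℝ) ^ T k * (T k + 1 : ℝ) ^ (a k * n k) *
      Real.exp (-(w k * n k / (32 * a k) * (δ * T k)))) l (𝓝 0) := by
  have hlim : Tendsto (fun k => Real.exp (-(n k : ℝ))) l (𝓝 0) :=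
    Real.tendsto_exp_neg_atTop_nhds_zero.comp (tendsto_natCast_atTop_atTop.comp hn)
  refine squeeze_zero' (Eventually.of_forall fun k => by positivity) ?_ hlim
  -- The exponent is cut into 8 shares of δ/256 · WNt/A. The assignments cost one share and the grid
  -- matrices two; since N is at most four shares, what remains beats exp(-N).
  have hc : 0 < δ / 256 := by positivity
  filter_upwards [h1.eventually (gt_mem_nhds hc), h2.eventually (gt_mem_nhds hc),
    hn.eventually_ge_atTop 1, hT.eventually_ge_atTop 2] with k e1 e2 hnk hTk
  have hak : (1 : ℝ) ≤ a k := by exact_mod_cast ha k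
  have hn1 : (1 : ℝ) ≤ n k := by exact_mod_cast hnk
  have hT2 : (2 : ℝ) ≤ T k := by exact_mod_cast hTk
  have hwk := hw k
  set A : ℝ := (a k : ℝ)
  set N : ℝ := (n k : ℝ)
  set t : ℝ := (T k : ℝ)
  set W : ℝ := w k
  have hA0 : 0 < A := by linarith
  have hN0 : 0 < N := by linarith
  have ht0 : 0 < t := by linarith
  rw [div_lt_iff₀ (by positivity)] at e1 e2
  have hlog : Real.log (t + 1) ≤ 2 * Real.log t := by
    rw [show 2 * Real.log t = Real.log (t ^ 2) by rw [Real.log_pow]; norm_num]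
    exact Real.log_le_log (by linarith) (by nlinarith)
  have hlog2 : 1 / 2 ≤ Real.log (t + 1) := by
    have := Real.log_two_gt_d9
    have := Real.log_le_log (by norm_num : (0 : ℝ) < 2) (by linarith : 2 ≤ t + 1)
    linarith
  have hprod : A ^ T k * (t + 1) ^ (a k * n k) * Real.exp (-(W * N / (32 * A) * (δ * t)))
      = Real.exp (t * Real.log A + A * N * Real.log (t + 1)
        - W * N / (32 * A) * (δ * t)) := by
    rw [sub_eq_add_neg, Real.exp_add, Real.exp_add]
    congr 2
    · rw [Real.exp_nat_mul, Real.exp_log hA0]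
    · rw [show A * N = ((a k * n k : ℕ) : ℝ) by push_cast; rfl, Real.exp_nat_mul,
        Real.exp_log (by linarith)]
  rw [hprod, Real.exp_le_exp]
  have hX : W * N / (32 * A) * (δ * t) = 8 * (δ / 256 * (W * N * t / A)) := by
    field_simp; ring
  have f1 : t * Real.log A ≤ δ / 256 * (W * N * t / A) := by
    rw [mul_div_assoc', le_div_iff₀ hA0]
    nlinarith
  have f2 : A * N * Real.log (t + 1) ≤ 2 * (δ / 256 * (W * N * t / A)) := by
    have : A ^ 2 * Real.log (t + 1) ≤ 2 * (δ / 256 * (W * t)) := by nlinarith [sq_nonneg A]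
    rw [mul_div_assoc', mul_div_assoc', le_div_iff₀ hA0]
    nlinarith
  have f3 : N * (1 / 2) ≤ A * N * Real.log (t + 1) :=
    mul_le_mul (by nlinarith) hlog2 (by norm_num) (by positivity)
  rw [hX]
  linarith

/-- The common part of both regimes: it remains to find likely sets `S k` on which feasible
assignments with many errors are at distance at least δT from every relabeling. -/
theorem tendsto_measure_numErrors {nL n T : ι → ℕ}
    {P : ∀ k, Params (nL k) (n k)} {Ω : ι → Type*} [∀ k, MeasurableSpace (Ω k)]
    {μ : ∀ k, Measure (Ω k)} [∀ k, IsProbabilityMeasure (μ k)]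
    {zs : ∀ k, Ω k → Fin (T k) → Fin (nL k)} {G : ∀ k, Ω k → Fin (T k) → Fin (n k) → Bool}
    (hsample : ∀ k, IsSample (P k) (μ k) (zs k) (G k))
    {zhat : ∀ k, Ω k → Fin (T k) → Fin (nL k)}
    (hzhat : ∀ k, ∀ᵐ ω ∂(μ k), IsMaxProfile (P k).le (G k ω) (zhat k ω))
    {d v : ι → ℝ} (hd : ∀ k, 0 < d k) (hv : ∀ k, 0 < v k)
    (hsep : ∀ k, Separated (P k) (d k) (v k))
    (hn : Tendsto n l atTop) (hT : Tendsto T l atTop)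
    (h1 : Tendsto (fun k => (nL k : ℝ) * Real.log (nL k) / (d k ^ 2 * v k * n k)) l (𝓝 0))
    (h2 : Tendsto (fun k => (nL k : ℝ) ^ 2 * Real.log (T k) / (d k ^ 2 * v k * T k)) l (𝓝 0))
    {ε δ : ℝ} (hδ : 0 < δ) (S : ∀ k, Set (Fin (T k) → Fin (nL k) × (Fin (n k) → Bool)))
    (hS : ∀ᶠ k in l, ∀ x ∈ S k, ∀ z : Fin (T k) → Fin (nL k),
      (∀ t, (x t).2 (Fin.castLE (P k).le (z t)) = true) →
      ε ≤ (numErrors (fun t => (x t).1) z : ℝ) / T k → ∀ f : Fin (nL k) → Fin (nL k),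
        δ * T k ≤ (Finset.univ.filter fun t => (x t).1 ≠ f (z t)).card)
    (hS0 : Tendsto (fun k => sampleProb (P k) (S k)ᶜ) l (𝓝 0)) :
    Tendsto (fun k => μ k {ω | ε ≤ (numErrors (zs k ω) (zhat k ω) : ℝ) / T k}) l (𝓝 0) := by
  have hlim := ENNReal.tendsto_ofReal (hS0.add (tendsto_union_bound (fun k => (P k).nL_pos)
    (fun k => mul_pos (pow_pos (hd k) 2) (hv k)) hδ hn hT h1 h2))
  rw [add_zero, ENNReal.ofReal_zero] at hlim
  refine tendsto_of_tendsto_of_tendsto_of_le_of_le' tendsto_const_nhds hlim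
    (Eventually.of_forall fun k => zero_le) ?_
  filter_upwards [hS] with k hk
  exact (hsample k).measure_numErrors_le (hzhat k) (hd k) (hv k) (hsep k) (S k) ε (δ * T k) hk

/-- Consistency when the number of hubs grows. -/
theorem tendsto_measure_numErrors_growing {nL n T : ι → ℕ}
    {P : ∀ k, Params (nL k) (n k)} {Ω : ι → Type*} [∀ k, MeasurableSpace (Ω k)]
    {μ : ∀ k, Measure (Ω k)} [∀ k, IsProbabilityMeasure (μ k)]
    {zs : ∀ k, Ω k → Fin (T k) → Fin (nL k)} {G : ∀ k, Ω k → Fin (T k) → Fin (n k) → Bool}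
    (hsample : ∀ k, IsSample (P k) (μ k) (zs k) (G k))
    {zhat : ∀ k, Ω k → Fin (T k) → Fin (nL k)}
    (hzhat : ∀ k, ∀ᵐ ω ∂(μ k), IsMaxProfile (P k).le (G k ω) (zhat k ω))
    {cmax : ℝ} (hρ : ∀ k i, (P k).ρ i ≤ cmax / nL k)
    {d v : ι → ℝ} (hd : ∀ k, 0 < d k) (hv : ∀ k, 0 < v k)
    (hsep : ∀ k, Separated (P k) (d k) (v k))
    (hn : Tendsto n l atTop) (hT : Tendsto T l atTop) (hnL : Tendsto nL l atTop)
    {c₀ : ℝ} (hc₀ : ∀ k, HubBound (P k) (c₀ / nL k))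
    (h0 : Tendsto (fun k => (nL k : ℝ) ^ 2 * Real.log (nL k) / T k) l (𝓝 0))
    (h2 : Tendsto (fun k => (nL k : ℝ) ^ 2 * Real.log (T k) / (d k ^ 2 * v k * T k)) l (𝓝 0))
    (h1 : Tendsto (fun k => (nL k : ℝ) ^ 2 * Real.log (nL k) / (d k ^ 4 * v k ^ 2 * n k))
      l (𝓝 0))
    {ε : ℝ} (hε : 0 < ε) :
    Tendsto (fun k => μ k {ω | ε ≤ (numErrors (zs k ω) (zhat k ω) : ℝ) / T k}) l (𝓝 0) := by
  -- The expected number of groups with hub i containing hub j is at most cmax · c₀ · T/n_L² ≤ M.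
  -- The added 1 gives M ≥ T/n_L², which eventually exceeds 4 log n_L and so pays for the n_L²
  -- pairs.
  set C : ℝ := |cmax * c₀| + 1 with hC
  have hC1 : 1 ≤ C := by rw [hC]; linarith [abs_nonneg (cmax * c₀)]
  let M : ι → ℝ := fun k => C * T k / (nL k : ℝ) ^ 2
  have ha : ∀ k, (1 : ℝ) ≤ nL k := fun k => by exact_mod_cast (P k).nL_pos
  refine tendsto_measure_numErrors hsample hzhat hd hv hsep hn hT ?_ h2 (half_pos hε)
    (fun k => {x | ∀ i j, i ≠ j → x ∈ {x | (hubCount (P k).le true x i j : ℝ) ≤ 3 * M k}})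
    ?_ ?_
  · refine squeeze_zero' (Eventually.of_forall fun k => ?_) ?_ h1
    · have := Real.log_nonneg (ha k)
      have := hd k
      have := hv k
      positivity
    · filter_upwards [hnL.eventually_ge_atTop 2] with k hk
      obtain ⟨hd1, hv1⟩ := (hsep k).bounds (hv k) hk
      have hdk := hd k
      have hvk := hv k
      have hlog := Real.log_nonneg (ha k)
      have hak := ha k
      have hNk : (0 : ℝ) < n k := by exact_mod_cast (P k).nL_pos.trans_le (P k).le
      rw [div_le_div_iff₀ (by positivity) (by positivity)]
      -- The union bound needs n_L log n_L/(d²vn) → 0, which is weaker than the given condition by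
      -- the factor n_L/(d²v) ≥ 1.
      have h3 : d k ^ 2 * v k ≤ nL k :=
        (mul_le_of_le_one_left hvk.le (pow_le_one₀ hdk.le hd1)).trans hv1
      calc (nL k : ℝ) * Real.log (nL k) * (d k ^ 4 * v k ^ 2 * n k)
          = (nL k : ℝ) * Real.log (nL k) * (d k ^ 2 * v k * n k) * (d k ^ 2 * v k) := by ring
        _ ≤ (nL k : ℝ) * Real.log (nL k) * (d k ^ 2 * v k * n k) * nL k :=
            mul_le_mul_of_nonneg_left h3 (by positivity)
        _ = _ := by ring
  · filter_upwards [hT.eventually_ge_atTop 1,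
      (tendsto_natCast_atTop_atTop (R := ℝ).comp hnL).eventually_ge_atTop (6 * C / ε)]
      with k hTk hak x hx z hz herr f
    have hTk' : (0 : ℝ) < T k := by exact_mod_cast hTk
    have ha0 : (0 : ℝ) < nL k := by linarith [ha k]
    have hM0 : 0 ≤ 3 * M k := by positivity
    have hle := numErrors_le_of_hubCount_true_le hM0 (fun i j hij => hx i j hij) hz f
    rw [le_div_iff₀ hTk'] at herr
    have hak' : 6 * C / ε ≤ nL k := hak
    rw [div_le_iff₀ hε] at hak'
    -- Relabeled groups account for at most half of the errors once n_L ≥ 6C/ε; the other half is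
    -- the distance to f(z).
    have h3 : nL k * (3 * M k) ≤ ε / 2 * T k := by
      have : nL k * (3 * M k) = 3 * C * T k / nL k := by
        simp only [M]; field_simp
      rw [this, div_le_iff₀ ha0]
      nlinarith
    linarith
  · have hlim : Tendsto (fun k => Real.exp (-(2 * Real.log (nL k)))) l (𝓝 0) := by
      refine Real.tendsto_exp_neg_atTop_nhds_zero.comp (Tendsto.const_mul_atTop (by norm_num) ?_)
      exact Real.tendsto_log_atTop.comp (tendsto_natCast_atTop_atTop.comp hnL)
    refine squeeze_zero' (Eventually.of_forall fun k => Finset.sum_nonneg fun x _ =>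
      Set.indicator_nonneg (fun x _ => prod_weight_nonneg _ x) x) ?_ hlim
    filter_upwards [h0.eventually (gt_mem_nhds (by norm_num : (0 : ℝ) < 1 / 4)),
      hT.eventually_ge_atTop 1] with k hk hTk
    have hTk' : (0 : ℝ) < T k := by exact_mod_cast hTk
    have ha0 : (0 : ℝ) < nL k := by linarith [ha k]
    refine (sampleProb_hubCount_true (P k) (M := M k) fun i j hij => ?_).trans ?_
    · have e1 : (P k).ρ i * (P k).A i (Fin.castLE (P k).le j) ≤ cmax / nL k * (c₀ / nL k) :=
        mul_le_mul (hρ k i) (hc₀ k i j hij) ((P k).A_mem.1 _ _).1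
          (((P k).ρ_nonneg i).trans (hρ k i))
      have e2 : cmax / nL k * (c₀ / nL k) ≤ C / (nL k : ℝ) ^ 2 := by
        rw [div_mul_div_comm, ← sq]
        exact div_le_div_of_nonneg_right (by rw [hC]; linarith [le_abs_self (cmax * c₀)])
          (by positivity)
      calc (T k : ℝ) * _ ≤ T k * (C / (nL k : ℝ) ^ 2) :=
            mul_le_mul_of_nonneg_left (e1.trans e2) hTk'.le
        _ = M k := by simp only [M]; ring
    · have e3 : (nL k : ℝ) ^ 2 = Real.exp (2 * Real.log (nL k)) := by
        rw [show (2 : ℝ) * Real.log (nL k) = (2 : ℕ) * Real.log (nL k) by norm_num,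
          Real.exp_nat_mul, Real.exp_log ha0]
      have e4 : 4 * Real.log (nL k) ≤ M k := by
        rw [div_lt_iff₀ hTk'] at hk
        simp only [M]
        rw [le_div_iff₀ (by positivity)]
        nlinarith
      rw [e3, ← Real.exp_add, Real.exp_le_exp]
      linarith

/-- Consistency for a fixed number of hubs. -/
theorem tendsto_measure_numErrors_fixed {nL n T : ι → ℕ}
    {P : ∀ k, Params (nL k) (n k)} {Ω : ι → Type*} [∀ k, MeasurableSpace (Ω k)]
    {μ : ∀ k, Measure (Ω k)} [∀ k, IsProbabilityMeasure (μ k)]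
    {zs : ∀ k, Ω k → Fin (T k) → Fin (nL k)} {G : ∀ k, Ω k → Fin (T k) → Fin (n k) → Bool}
    (hsample : ∀ k, IsSample (P k) (μ k) (zs k) (G k))
    {zhat : ∀ k, Ω k → Fin (T k) → Fin (nL k)}
    (hzhat : ∀ k, ∀ᵐ ω ∂(μ k), IsMaxProfile (P k).le (G k ω) (zhat k ω))
    {cmin : ℝ} (hcmin : 0 < cmin) (hρ : ∀ k i, cmin / nL k ≤ (P k).ρ i)
    {d v : ι → ℝ} (hd : ∀ k, 0 < d k) (hv : ∀ k, 0 < v k)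
    (hsep : ∀ k, Separated (P k) (d k) (v k))
    (hn : Tendsto n l atTop) (hT : Tendsto T l atTop) {m : ℕ} (hm : ∀ k, nL k = m)
    {c : ℝ} (hc1 : c < 1) (hc : ∀ k, HubBound (P k) c)
    (h2 : Tendsto (fun k => Real.log (T k) / (d k ^ 2 * v k * T k)) l (𝓝 0))
    (h1 : Tendsto (fun k => d k ^ 4 * v k ^ 2 * (n k : ℝ)) l atTop)
    {ε : ℝ} (hε : 0 < ε) :
    Tendsto (fun k => μ k {ω | ε ≤ (numErrors (zs k ω) (zhat k ω) : ℝ) / T k}) l (𝓝 0) := by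
  -- With fewer than two hubs there are no errors, and separation does not bound `d`.
  rcases lt_or_ge m 2 with hm2 | hm2
  · have hempty : ∀ k, {ω | ε ≤ (numErrors (zs k ω) (zhat k ω) : ℝ) / T k} = ∅ := by
      intro k
      have : Subsingleton (Fin (nL k)) := Fin.subsingleton_iff_le_one.2 (by rw [hm k]; omega)
      refine Set.eq_empty_of_forall_notMem fun ω hω => ?_
      have h0 : numErrors (zs k ω) (zhat k ω) = 0 := by
        simp [numErrors, Subsingleton.elim (zs k ω) (zhat k ω)]
      have hω' : ε ≤ (numErrors (zs k ω) (zhat k ω) : ℝ) / T k := hω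
      rw [h0] at hω'
      simp at hω'
      linarith
    simp only [hempty, measure_empty]
    exact tendsto_const_nhds
  have hm0 : (0 : ℝ) < m := by exact_mod_cast (by omega : 0 < m)
  -- A lower bound for the probability that a group has hub i and omits a given other hub j.
  set q : ℝ := cmin / m * (1 - c) with hq
  have hq0 : 0 < q := mul_pos (by positivity) (by linarith)
  refine tendsto_measure_numErrors hsample hzhat hd hv hsep hn hT ?_ ?_
    -- For f = id the distance is the number of errors, at least εT; for any other f it is at least
    -- qT/4.
    (lt_min hε (by positivity : 0 < q / 4))
    (fun k => {x | ∀ i j, i ≠ j →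
      x ∈ {x | T k * q / 4 < (hubCount (P k).le false x i j : ℝ)}}) ?_ ?_
  · have h3 : Tendsto (fun k => d k ^ 2 * v k * (n k : ℝ)) l atTop := by
      refine tendsto_atTop_mono (fun k => ?_) (h1.const_mul_atTop (inv_pos.2 hm0))
      obtain ⟨hd1, hv1⟩ := (hsep k).bounds (hv k) (by rw [hm k]; exact hm2)
      have hdk := hd k
      have hvk := hv k
      rw [hm k] at hv1
      have h4 : d k ^ 2 * v k ≤ m :=
        (mul_le_of_le_one_left hvk.le (pow_le_one₀ hdk.le hd1)).trans hv1
      rw [inv_mul_le_iff₀ hm0]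
      calc d k ^ 4 * v k ^ 2 * (n k : ℝ) = d k ^ 2 * v k * (d k ^ 2 * v k * n k) := by ring
        _ ≤ _ := mul_le_mul_of_nonneg_right h4 (by positivity)
    simp only [hm]
    exact h3.const_div_atTop _
  · simp only [hm, mul_div_assoc]
    simpa using h2.const_mul ((m : ℝ) ^ 2)
  · filter_upwards [hT.eventually_ge_atTop 1] with k hTk x hx z hz herr f
    have hTk' : (0 : ℝ) < T k := by exact_mod_cast hTk
    by_cases hf : f = id
    · subst hf
      rw [le_div_iff₀ hTk'] at herr
      exact (mul_le_mul_of_nonneg_right (min_le_left _ _) hTk'.le).trans herr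
    · refine le_trans ?_ (le_card_ne_of_lt_hubCount_false (by rw [hm k]; exact hm2)
        (fun i j hij => hx i j hij) hz f hf)
      refine (mul_le_mul_of_nonneg_right (min_le_right _ _) hTk'.le).trans_eq (by ring)
  · have hlim : Tendsto (fun k => (m : ℝ) ^ 2 * Real.exp (-(T k * q / 4))) l (𝓝 0) := by
      have : Tendsto (fun k => (T k : ℝ) * q / 4) l atTop :=
        ((tendsto_natCast_atTop_atTop.comp hT).atTop_mul_const hq0).atTop_div_const (by norm_num)
      simpa using (Real.tendsto_exp_neg_atTop_nhds_zero.comp this).const_mul ((m : ℝ) ^ 2)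
    refine squeeze_zero (fun k => Finset.sum_nonneg fun x _ =>
      Set.indicator_nonneg (fun x _ => prod_weight_nonneg _ x) x) (fun k => ?_) hlim
    rw [← hm k]
    refine sampleProb_hubCount_false (P k) fun i j hij => ?_
    refine mul_le_mul_of_nonneg_left ?_ (Nat.cast_nonneg _)
    rw [hq, ← hm k]
    exact mul_le_mul (hρ k i) (by linarith [hc k i j hij]) (by linarith) ((P k).ρ_nonneg i)

end asymptotics

end HubModel

end

theorem theorem4 {ι : Type*} (l : Filter ι) (nL n T : ι → ℕ)
    (P : ∀ k, HubModel.Params (nL k) (n k))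
    (Ω : ι → Type*) [∀ k, MeasurableSpace (Ω k)]
    (μ : ∀ k, Measure (Ω k)) [∀ k, IsProbabilityMeasure (μ k)]
    (zs : ∀ k, Ω k → Fin (T k) → Fin (nL k))
    (G : ∀ k, Ω k → Fin (T k) → Fin (n k) → Bool)
    (hsample : ∀ k, HubModel.IsSample (P k) (μ k) (zs k) (G k))
    (zhat : ∀ k, Ω k → Fin (T k) → Fin (nL k))
    (hzhat : ∀ k, ∀ᵐ ω ∂(μ k), HubModel.IsMaxProfile (P k).le (G k ω) (zhat k ω))
    (cmin cmax : ℝ) (hcmin : 0 < cmin)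
    (hρ : ∀ k i, cmin / nL k ≤ (P k).ρ i ∧ (P k).ρ i ≤ cmax / nL k)
    (d v : ι → ℝ) (hd : ∀ k, 0 < d k) (hv : ∀ k, 0 < v k)
    (hsep : ∀ k, HubModel.Separated (P k) (d k) (v k))
    (hn : Tendsto n l atTop) (hT : Tendsto T l atTop) :
    -- growing number of hubs
    (Tendsto nL l atTop →
      (∃ c₀ : ℝ, 0 < c₀ ∧ ∀ k, HubModel.HubBound (P k) (c₀ / nL k)) →
      Tendsto (fun k => (nL k : ℝ) ^ 2 * Real.log (nL k) / T k) l (𝓝 0) →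
      Tendsto (fun k => (nL k : ℝ) ^ 2 * Real.log (T k) / (d k ^ 2 * v k * T k)) l (𝓝 0) →
      Tendsto (fun k => (nL k : ℝ) ^ 2 * Real.log (nL k) / (d k ^ 4 * v k ^ 2 * n k)) l (𝓝 0) →
      ∀ ε : ℝ, 0 < ε → Tendsto
        (fun k => μ k {ω | ε ≤ (HubModel.numErrors (zs k ω) (zhat k ω) : ℝ) / T k}) l (𝓝 0)) ∧
    -- fixed number of hubs
    ((∃ m : ℕ, ∀ k, nL k = m) →
      (∃ c : ℝ, c < 1 ∧ ∀ k, HubModel.HubBound (P k) c) →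
      Tendsto (fun k => Real.log (T k) / (d k ^ 2 * v k * T k)) l (𝓝 0) →
      Tendsto (fun k => d k ^ 4 * v k ^ 2 * (n k : ℝ)) l atTop →
      ∀ ε : ℝ, 0 < ε → Tendsto
        (fun k => μ k {ω | ε ≤ (HubModel.numErrors (zs k ω) (zhat k ω) : ℝ) / T k}) l (𝓝 0)) ∧
    -- fixed number of hubs, constant `d` and `v`
    ((∃ m : ℕ, ∀ k, nL k = m) →
      (∃ c : ℝ, c < 1 ∧ ∀ k, HubModel.HubBound (P k) c) →
      (∃ d₀ : ℝ, ∀ k, d k = d₀) → (∃ v₀ : ℝ, ∀ k, v k = v₀) →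
      ∀ ε : ℝ, 0 < ε → Tendsto
        (fun k => μ k {ω | ε ≤ (HubModel.numErrors (zs k ω) (zhat k ω) : ℝ) / T k}) l (𝓝 0)) := by
  refine ⟨fun hnL ⟨c₀, _, hc₀⟩ h0 h2 h1 ε hε => ?_, fun ⟨m, hm⟩ ⟨c, hc1, hc⟩ h2 h1 ε hε => ?_,
    fun ⟨m, hm⟩ ⟨c, hc1, hc⟩ ⟨d₀, hd₀⟩ ⟨v₀, hv₀⟩ ε hε => ?_⟩
  · exact HubModel.tendsto_measure_numErrors_growing hsample hzhat (fun k i => (hρ k i).2) hd hv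
      hsep hn hT hnL hc₀ h0 h2 h1 hε
  · exact HubModel.tendsto_measure_numErrors_fixed hsample hzhat hcmin (fun k i => (hρ k i).1) hd
      hv hsep hn hT hm hc1 hc h2 h1 hε
  · rcases isEmpty_or_nonempty ι with hι | ⟨⟨k₀⟩⟩
    · rw [Filter.filter_eq_bot_of_isEmpty l]
      exact tendsto_bot
    have hd0 : 0 < d₀ := hd₀ k₀ ▸ hd k₀
    have hv0 : 0 < v₀ := hv₀ k₀ ▸ hv k₀
    refine HubModel.tendsto_measure_numErrors_fixed hsample hzhat hcmin (fun k i => (hρ k i).1) hd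
      hv hsep hn hT hm hc1 hc ?_ ?_ hε
    · have hlog : Tendsto (fun x : ℝ => Real.log x / x) atTop (𝓝 0) :=
        Real.isLittleO_log_id_atTop.tendsto_div_nhds_zero
      have h := (hlog.comp (tendsto_natCast_atTop_atTop.comp hT)).div_const (d₀ ^ 2 * v₀)
      rw [zero_div] at h
      refine h.congr fun k => ?_
      rw [hd₀, hv₀, Function.comp_apply, Function.comp_apply, div_div, mul_comm (T k : ℝ)]
    · simp only [hd₀, hv₀]
      exact (tendsto_natCast_atTop_atTop.comp hn).const_mul_atTop (by positivity)
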